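/- Let $\Sigma$ be a relational signature (relation symbols only, of arbitrary cardinality) and let $T$ be a set of positive existential $\Sigma$-sentences, i.e. sentences built from atomic formulas (including equations), $\bot$ and $\top$ by $\wedge$, $\vee$ and $\exists$. All structures are $\Sigma$-structures with nonempty carrier, and "countable" means finite or countably infinite. A structure $\mathbf A$ is weakly oligomorphic if for every $n$ there are only finitely many relations $\varrho\subseteq A^n$ of the form $\varrho=\bigcap_{\varphi\in\Phi}\varphi^{\mathbf A}$, where $\Phi$ is a set of positive existential formulas with free variables among $x_1,\dots,x_n$; it is oligomorphic if for every $n$ the group $\operatorname{Aut}(\mathbf A)$ has only finitely many orbits on $A^n$. A first-order theory is $\omega$-categorical if it has, up to isomorphism, exactly one countably infinite model. The positive existential theory of $\mathbf A$ is the set of all positive existential sentences true in $\mathbf A$, and the positive existential part of a theory is the set of all positive existential sentences that follow from it. Consider the statements 1. $T$ is the positive existential theory of a countable weakly oligomorphic structure; 2. $T$ is the positive existential part of a complete $\omega$-categorical theory; 3. $T$ is the positive existential theory of a countable oligomorphic structure. If $\Sigma$ is countable, then 1, 2 and 3 are equivalent. For $\Sigma$ of arbitrary cardinality, 1 and 3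 are equivalent, and each of them implies 2. -/

import Mathlib

open FirstOrder

universe u v w

namespace FirstOrder.Language

/-- Positive existential formulas: built from atomic formulas (and the logical constants `⊥`, `⊤`)
by conjunction, disjunction and existential quantification. -/
inductive BoundedFormula.IsPositiveExistential {L : Language.{u, v}} {α : Type} :
    ∀ {n : ℕ}, L.BoundedFormula α n → Prop
  | of_isAtomic {n : ℕ} {φ : L.BoundedFormula α n} (h : φ.IsAtomic) : IsPositiveExistential φ
  | bot {n : ℕ} : IsPositiveExistential (⊥ : L.BoundedFormula α n)
  | top {n : ℕ} : IsPositiveExistential (⊤ : L.BoundedFormula α n)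
  | inf {n : ℕ} {φ ψ : L.BoundedFormula α n} (hφ : IsPositiveExistential φ)
      (hψ : IsPositiveExistential ψ) : IsPositiveExistential (φ ⊓ ψ)
  | sup {n : ℕ} {φ ψ : L.BoundedFormula α n} (hφ : IsPositiveExistential φ)
      (hψ : IsPositiveExistential ψ) : IsPositiveExistential (φ ⊔ ψ)
  | ex {n : ℕ} {φ : L.BoundedFormula α (n + 1)} (h : IsPositiveExistential φ) :
      IsPositiveExistential φ.ex

section Structures

variable (L : Language.{u, v}) (A : Type w) [L.Structure A]

/-- The relation defined in `A` by a set `Φ` of formulas with free variables among `x₁, …, xₙ`. -/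
def typeRelation {n : ℕ} (Φ : Set (L.Formula (Fin n))) : Set (Fin n → A) :=
  {a | ∀ φ ∈ Φ, φ.Realize a}

/-- For every arity, only finitely many relations are definable by positive existential types. -/
def IsWeaklyOligomorphic : Prop :=
  ∀ n : ℕ, {R : Set (Fin n → A) | ∃ Φ : Set (L.Formula (Fin n)),
    (∀ φ ∈ Φ, φ.IsPositiveExistential) ∧ R = L.typeRelation A Φ}.Finite

/-- The orbit of an `n`-tuple under the automorphism group of `A`. -/
def autOrbit {n : ℕ} (a : Fin n → A) : Set (Fin n → A) :=
  {b | ∃ g : A ≃[L] A, b = g ∘ a}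

/-- For every `n`, the automorphism group of `A` has only finitely many orbits of `n`-tuples. -/
def IsOligomorphic : Prop :=
  ∀ n : ℕ, (Set.range fun a : Fin n → A => L.autOrbit A a).Finite

/-- The set of all positive existential sentences that hold in `A`. -/
def positiveExistentialTheory : Set L.Sentence :=
  {φ | φ.IsPositiveExistential ∧ A ⊨ φ}

end Structures

section Theories

variable {L : Language.{u, v}}

/-- The set of all positive existential consequences of a theory. -/
def Theory.positiveExistentialPart (S : L.Theory) : Set L.Sentence :=
  {φ | φ.IsPositiveExistential ∧ S ⊨ᵇ φ}

/-- A theory is `ω`-categorical if it has, up to isomorphism, exactly one countably infinite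
model. -/
def Theory.IsOmegaCategorical (S : L.Theory) : Prop :=
  (∃ M : Theory.ModelType.{u, v, w} S, Cardinal.mk M = Cardinal.aleph0.{w}) ∧
    Cardinal.Categorical Cardinal.aleph0.{w} S

/-- `T` is the positive existential theory of a (nonempty) countable weakly oligomorphic
structure. -/
def IsTheoryOfWeaklyOligomorphic (T : Set L.Sentence) : Prop :=
  ∃ (A : Type w) (_ : L.Structure A), Nonempty A ∧ Countable A ∧ L.IsWeaklyOligomorphic A ∧
    T = L.positiveExistentialTheory A

/-- `T` is the positive existential part of a complete `ω`-categorical theory. -/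
def IsPartOfOmegaCategorical (T : Set L.Sentence) : Prop :=
  ∃ S : L.Theory, S.IsComplete ∧ Theory.IsOmegaCategorical.{u, v, w} S ∧
    T = S.positiveExistentialPart

/-- `T` is the positive existential theory of a (nonempty) countable oligomorphic structure. -/
def IsTheoryOfOligomorphic (T : Set L.Sentence) : Prop :=
  ∃ (A : Type w) (_ : L.Structure A), Nonempty A ∧ Countable A ∧ L.IsOligomorphic A ∧
    T = L.positiveExistentialTheory A

end Theories

end FirstOrder.Language

/-! From 1 to 3: a weakly oligomorphic `A` realises finitely many positive existential types of each
arity, so each realised type is generated by one formula and lies below a maximal realised one. A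
chain of choices inside `A` gives a substructure whose tuples all have maximal type
(`exists_posMaximal_substructure`). It satisfies a positive Tarski–Vaught test, so its positive
existential theory is that of `A`; maximality turns inclusions of types into equalities, so equality
of types is a back-and-forth system and the substructure is oligomorphic. The choices are driven by
elements of `A`, not by formulas, so the signature may have any size. The converse holds because
definable relations are unions of orbits.

From 3 to 2: the given structure may be finite, so every element is replaced by infinitely many
copies. The blow-up is homomorphically equivalent to the original and still oligomorphic, and
back-and-forth makes its complete theory `ω`-categorical.

From 2 to 3 (Ryll-Nardzewski), where countability of the signature enters: by compactness and
Löwenheim–Skolem the countable model `M` realises all types. Hence isolated types are dense, and `M`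
has an elementary substructure with only isolated types. Categoricity makes this isomorphic to `M`,
so all types in `M` are isolated, and by compactness there are finitely many of each arity. -/

namespace FirstOrder.Language

/-! ### Sequences meeting countably many requirements -/

section Sequences

/-- The sequence in which every entry is computed from the preceding ones by `step`. -/
def seqOfStep {A : Type*} (step : ∀ n : ℕ, (Fin n → A) → A) : ℕ → A
  | n => step n fun i : Fin n => seqOfStep step i
decreasing_by exact i.2

theorem fin_succ_restrict {A : Type*} (c : ℕ → A) (n : ℕ) :
    (fun i : Fin (n + 1) => c i) = Fin.snoc (fun i : Fin n => c i) (c n) := by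
  ext i
  refine Fin.lastCases ?_ (fun i => ?_) i <;> simp

/-- A sequence all of whose initial segments are `Good`, and which meets each of countably many
requirements arbitrarily late. -/
theorem exists_seq_of_extension {A B : Type*} [Countable B] [Nonempty B]
    (Good : ∀ n : ℕ, (Fin n → A) → Prop) (Q : ∀ n : ℕ, (Fin n → A) → B → A → Prop)
    (h0 : ∀ p, Good 0 p)
    (hs : ∀ n p b, Good n p → ∃ c, Good (n + 1) (Fin.snoc p c) ∧ Q n p b c) :
    ∃ c : ℕ → A, (∀ n, Good n fun i => c i) ∧
      ∀ n b, ∃ s ≥ n, Q s (fun i : Fin s => c i) b (c s) := by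
  classical
  obtain ⟨e, he⟩ := exists_surjective_nat B
  obtain ⟨a0, -⟩ := hs 0 Fin.elim0 (e 0) (h0 _)
  let step : ∀ n : ℕ, (Fin n → A) → A := fun n p =>
    if h : Good n p then (hs n p (e n.unpair.2) h).choose else a0
  let c := seqOfStep step
  have hc : ∀ n, c n = step n fun i : Fin n => c i := fun n => by
    change seqOfStep step n = _
    rw [seqOfStep]
  have key : ∀ n, Good n (fun i => c i) → Good (n + 1) (fun i => c i) ∧
      Q n (fun i : Fin n => c i) (e n.unpair.2) (c n) := fun n h => by
    have := (hs n _ (e n.unpair.2) h).choose_spec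
    have h2 : c n = (hs n _ (e n.unpair.2) h).choose := by
      rw [hc n]; exact dif_pos h
    rw [fin_succ_restrict, h2]
    exact this
  have good : ∀ n, Good n fun i => c i := fun n => by
    induction n with
    | zero => exact h0 _
    | succ n ih => exact (key n ih).1
  refine ⟨c, good, fun n b => ?_⟩
  obtain ⟨k, rfl⟩ := he b
  -- Stage `Nat.pair n k` treats requirement `k`, so each requirement recurs at arbitrarily late
  -- stages.
  refine ⟨Nat.pair n k, Nat.left_le_pair n k, ?_⟩
  have := (key (Nat.pair n k) (good _)).2
  rwa [Nat.unpair_pair] at this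

theorem exists_bounded_indices {A : Type*} (c : ℕ → A) {n : ℕ} (a : Fin n → Set.range c) :
    ∃ f : Fin n → ℕ, ∃ m, ∀ i, f i < m ∧ (a i).1 = c (f i) := by
  choose f hf using fun i => (a i).2
  obtain ⟨m, hm⟩ := Finite.exists_le f
  exact ⟨f, m + 1, fun i => ⟨Nat.lt_succ_of_le (hm i), (hf i).symm⟩⟩

end Sequences

/-! ### Back-and-forth systems -/

section BackAndForth

variable {L : Language.{u, v}} [L.IsRelational] {M N : Type*} [L.Structure M] [L.Structure N]

/-- A system of partial isomorphisms between tuples with the back-and-forth property. -/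
structure IsBackAndForth (L : Language.{u, v}) {M N : Type*} [L.Structure M] [L.Structure N]
    (E : ∀ n : ℕ, (Fin n → M) → (Fin n → N) → Prop) : Prop where
  eq_iff : ∀ {n a b}, E n a b → ∀ i j, a i = a j ↔ b i = b j
  rel_iff : ∀ {n a b}, E n a b → ∀ {k : ℕ} (R : L.Relations k) (f : Fin k → Fin n),
    Structure.RelMap R (a ∘ f) ↔ Structure.RelMap R (b ∘ f)
  forth : ∀ {n a b}, E n a b → ∀ x, ∃ y, E (n + 1) (Fin.snoc a x) (Fin.snoc b y)
  back : ∀ {n a b}, E n a b → ∀ y, ∃ x, E (n + 1) (Fin.snoc a x) (Fin.snoc b y)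

theorem append_snoc_eq {A : Type*} {n m : ℕ} (a : Fin n → A) (p : Fin m → A) (x : A) :
    Fin.append a (Fin.snoc p x : Fin (m + 1) → A) = Fin.snoc (Fin.append a p) x :=
  by rw [Fin.snoc_eq_append, Fin.snoc_eq_append, Fin.append_assoc]; rfl

/-- Countable structures linked by a back-and-forth system are isomorphic, by an isomorphism that
extends a given partial one. -/
theorem IsBackAndForth.exists_equiv [Countable M] [Countable N] [Nonempty M]
    {E : ∀ n : ℕ, (Fin n → M) → (Fin n → N) → Prop} (hE : IsBackAndForth L E)
    {n : ℕ} {a : Fin n → M} {b : Fin n → N} (hab : E n a b) :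
    ∃ g : M ≃[L] N, b = g ∘ a := by
  -- The sequence lists the graph of the isomorphism, beyond the given pairs `(a, b)`; the
  -- requirements `M ⊕ N` make it total and surjective.
  obtain ⟨c, hc, hQ⟩ := exists_seq_of_extension (A := M × N) (B := M ⊕ N)
    (fun m p => E (n + m) (Fin.append a (Prod.fst ∘ p)) (Fin.append b (Prod.snd ∘ p)))
    (fun m p s c => Sum.elim (fun x => c.1 = x) (fun y => c.2 = y) s)
    (fun p => by
      rw [Subsingleton.elim (Prod.fst ∘ p) Fin.elim0, Subsingleton.elim (Prod.snd ∘ p) Fin.elim0,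
        Fin.append_elim0, Fin.append_elim0]
      exact hab)
    (fun m p s h => by
      rcases s with x | y
      · obtain ⟨y, hy⟩ := hE.forth h x
        exact ⟨(x, y), by
          rw [Fin.comp_snoc, Fin.comp_snoc, append_snoc_eq, append_snoc_eq]; exact hy, rfl⟩
      · obtain ⟨x, hx⟩ := hE.back h y
        exact ⟨(x, y), by
          rw [Fin.comp_snoc, Fin.comp_snoc, append_snoc_eq, append_snoc_eq]; exact hx, rfl⟩)
  have heq : ∀ i j, (c i).1 = (c j).1 ↔ (c i).2 = (c j).2 := fun i j => by
    have := hE.eq_iff (hc (max i j + 1)) (Fin.natAdd n ⟨i, by omega⟩) (Fin.natAdd n ⟨j, by omega⟩)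
    simpa only [Fin.append_right, Function.comp_apply] using this
  have h1 : ∀ x, ∃ s, (c s).1 = x := fun x => by
    obtain ⟨s, -, h⟩ := hQ 0 (Sum.inl x); exact ⟨s, h⟩
  have h2 : ∀ y, ∃ s, (c s).2 = y := fun y => by
    obtain ⟨s, -, h⟩ := hQ 0 (Sum.inr y); exact ⟨s, h⟩
  choose f hf using h1
  choose g hg using h2
  have hgf : ∀ s, (c (f (c s).1)).2 = (c s).2 := fun s => (heq _ _).1 (hf _)
  have hfg : ∀ s, (c (g (c s).2)).1 = (c s).1 := fun s => (heq _ _).2 (hg _)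
  refine ⟨⟨⟨fun x => (c (f x)).2, fun y => (c (g y)).1, fun x => ?_, fun y => ?_⟩,
    fun F => isEmptyElim F, fun {k} R x => ?_⟩, ?_⟩
  · change (c (g (c (f x)).2)).1 = x
    rw [hfg, hf]
  · change (c (f (c (g y)).1)).2 = y
    rw [hgf, hg]
  · obtain ⟨m, hm⟩ : ∃ m, ∀ i, f (x i) < m :=
      ⟨Finset.univ.sup (fun i => f (x i)) + 1, fun i =>
        Nat.lt_succ_of_le (Finset.le_sup (f := fun i => f (x i)) (Finset.mem_univ i))⟩
    have := hE.rel_iff (hc m) R (fun i => Fin.natAdd n ⟨f (x i), hm i⟩)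
    have e1 : Fin.append a (Prod.fst ∘ fun i : Fin m => c i) ∘
        (fun i => Fin.natAdd n ⟨f (x i), hm i⟩) = x := by
      ext i; simp only [Function.comp_apply, Fin.append_right, hf]
    have e2 : Fin.append b (Prod.snd ∘ fun i : Fin m => c i) ∘
        (fun i => Fin.natAdd n ⟨f (x i), hm i⟩) = (fun x => (c (f x)).2) ∘ x := by
      ext i; simp only [Function.comp_apply, Fin.append_right]
    rw [e1, e2] at this
    exact this.symm
  · ext i
    have := hE.eq_iff (hc (f (a i) + 1)) (Fin.castAdd _ i) (Fin.natAdd n ⟨f (a i), by omega⟩)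
    simp only [Fin.append_left, Fin.append_right, Function.comp_apply, hf, true_iff] at this
    exact this

end BackAndForth

/-! ### Operations on formulas, and isolating formulas -/

section Formulas

variable {L : Language.{u, v}}

/-- Existential quantification over the last free variable. -/
def Formula.exLast {n : ℕ} (φ : L.Formula (Fin (n + 1))) : L.Formula (Fin n) :=
  (BoundedFormula.relabel (n := 1) (k := 0)
    (fun i : Fin (n + 1) => (Fin.lastCases (Sum.inr 0) Sum.inl i : Fin n ⊕ Fin 1)) φ).ex

theorem Formula.realize_exLast {A : Type*} [L.Structure A] {n : ℕ} (φ : L.Formula (Fin (n + 1)))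
    (a : Fin n → A) : φ.exLast.Realize a ↔ ∃ x, φ.Realize (Fin.snoc a x : Fin (n + 1) → A) := by
  unfold Formula.exLast Formula.Realize
  rw [BoundedFormula.realize_ex]
  refine exists_congr fun x => ?_
  rw [BoundedFormula.realize_relabel]
  refine iff_of_eq (congr_arg₂ _ ?_ (Subsingleton.elim _ _))
  ext i
  refine Fin.lastCases ?_ (fun i => ?_) i <;> simp [Fin.snoc]

/-- The formula `φ` as a formula in free variables only, after a substitution of variables. -/
def BoundedFormula.flatten {α β : Type} {k : ℕ} (φ : L.BoundedFormula α k)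
    (g : α ⊕ Fin k → β) : L.Formula β :=
  φ.toFormula.relabel g

theorem BoundedFormula.realize_flatten {A : Type*} [L.Structure A] {α β : Type} {k : ℕ}
    (φ : L.BoundedFormula α k) (g : α ⊕ Fin k → β) (v : β → A) :
    (φ.flatten g).Realize v ↔ φ.Realize (v ∘ g ∘ Sum.inl) (v ∘ g ∘ Sum.inr) := by
  unfold BoundedFormula.flatten
  rw [Formula.realize_relabel, BoundedFormula.realize_toFormula]
  rfl

namespace BoundedFormula.IsPositiveExistential

variable {α β : Type}

theorem relabel {m k : ℕ} {φ : L.BoundedFormula α k} (h : φ.IsPositiveExistential)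
    (g : α → β ⊕ Fin m) : (φ.relabel g).IsPositiveExistential := by
  induction h with
  | of_isAtomic h => exact .of_isAtomic (h.relabel g)
  | bot => exact .bot
  | top => exact .top
  | inf _ _ h1 h2 => exact .inf h1 h2
  | sup _ _ h1 h2 => exact .sup h1 h2
  | ex _ ih => rw [relabel_ex]; exact .ex ih

theorem toFormula {k : ℕ} {φ : L.BoundedFormula α k} (h : φ.IsPositiveExistential) :
    φ.toFormula.IsPositiveExistential := by
  induction h with
  | of_isAtomic h =>
    refine .of_isAtomic ?_
    cases h with
    | equal t₁ t₂ => exact .equal _ _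
    | rel R ts => exact .rel _ _
  | bot => exact .bot
  | top => exact .top
  | inf _ _ h1 h2 => exact .inf h1 h2
  | sup _ _ h1 h2 => exact .sup h1 h2
  | ex _ ih => exact .ex (ih.relabel _)

theorem flatten {k : ℕ} {φ : L.BoundedFormula α k} (h : φ.IsPositiveExistential)
    (g : α ⊕ Fin k → β) : (φ.flatten g).IsPositiveExistential :=
  h.toFormula.relabel _

theorem exLast {n : ℕ} {φ : L.Formula (Fin (n + 1))} (h : φ.IsPositiveExistential) :
    φ.exLast.IsPositiveExistential :=
  .ex (h.relabel _)

theorem iInf {k : ℕ} {ι : Type*} [Finite ι] {f : ι → L.BoundedFormula α k}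
    (h : ∀ i, (f i).IsPositiveExistential) :
    (BoundedFormula.iInf f).IsPositiveExistential := by
  let := Fintype.ofFinite ι
  change (((Finset.univ : Finset ι).toList.map f).foldr (· ⊓ ·) ⊤).IsPositiveExistential
  generalize (Finset.univ : Finset ι).toList = l
  induction l with
  | nil => exact .top
  | cons i l ih => exact .inf (h i) ih

/-- Homomorphisms preserve positive existential formulas. -/
theorem realize_hom {A B : Type*} [L.Structure A] [L.Structure B] (f : A →[L] B) {k : ℕ}
    {φ : L.BoundedFormula α k} (h : φ.IsPositiveExistential) {v : α → A} {xs : Fin k → A}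
    (hr : φ.Realize v xs) : φ.Realize (f ∘ v) (f ∘ xs) := by
  induction h with
  | of_isAtomic h =>
    cases h with
    | equal t₁ t₂ =>
      simp only [realize_bdEqual, ← Sum.comp_elim, HomClass.realize_term] at *
      rw [hr]
    | rel R ts =>
      simp only [realize_rel, ← Sum.comp_elim, HomClass.realize_term] at *
      exact f.map_rel R _ hr
  | bot => exact hr
  | top => simp
  | inf _ _ h1 h2 => rw [realize_inf] at *; exact ⟨h1 hr.1, h2 hr.2⟩
  | sup _ _ h1 h2 => rw [realize_sup] at *; exact hr.imp h1 h2
  | ex _ ih =>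
    rw [realize_ex] at *
    obtain ⟨x, hx⟩ := hr
    exact ⟨f x, by simpa [Fin.comp_snoc] using ih hx⟩

end BoundedFormula.IsPositiveExistential

/-- If the tuples realise finitely many sets of formulas from a class closed under finite
conjunctions, then each of these sets is generated by a single formula. -/
theorem exists_isolating_formula {A : Type*} [L.Structure A] {n : ℕ} (K : Set (L.Formula (Fin n)))
    (hK : ∀ (ι : Set (Set (L.Formula (Fin n)))) [Finite ι] (f : ι → L.Formula (Fin n)),
      (∀ i, f i ∈ K) → BoundedFormula.iInf f ∈ K)
    (hfin : (Set.range fun a : Fin n → A => {φ ∈ K | φ.Realize a}).Finite) (a : Fin n → A) :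
    ∃ θ ∈ K, θ.Realize a ∧ ∀ b : Fin n → A, θ.Realize b → ∀ φ ∈ K, φ.Realize a → φ.Realize b := by
  classical
  -- The realised types that fail to contain the type of `a`: one formula separating `a` from each
  -- of them suffices, and their finite conjunction is the generator.
  let I : Set (Set (L.Formula (Fin n))) :=
    {t ∈ Set.range fun a : Fin n → A => {φ ∈ K | φ.Realize a} | ∃ φ ∈ K, φ.Realize a ∧ φ ∉ t}
  have : Finite I := (hfin.subset (Set.sep_subset _ _)).to_subtype
  have hI : ∀ t : I, ∃ φ ∈ K, φ.Realize a ∧ φ ∉ t.1 := fun t => t.2.2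
  choose f hfK hfa hft using hI
  refine ⟨BoundedFormula.iInf f, hK I f hfK, ?_, fun b hb φ hφ ha => ?_⟩
  · exact Formula.realize_iInf.2 hfa
  · by_contra hn
    let t : I := ⟨{φ ∈ K | φ.Realize b}, ⟨b, rfl⟩, φ, hφ, ha, fun h => hn h.2⟩
    exact hft t ⟨hfK t, Formula.realize_iInf.1 hb t⟩

end Formulas

end FirstOrder.Language

namespace FirstOrder.Language

/-! ### Projections of tuples, and a criterion for oligomorphy -/

section Tuples

variable {L : Language.{u, v}}

/-- The formula describing the tuples `z ∘ g`, where `z` satisfies `θ`. -/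
noncomputable def Formula.imageComp {n m : ℕ} (g : Fin n → Fin m) (θ : L.Formula (Fin m)) :
    L.Formula (Fin n) :=
  Formula.iExs (Fin m) ((θ.relabel Sum.inr : L.Formula (Fin n ⊕ Fin m)) ⊓
    BoundedFormula.iInf fun i : Fin n =>
      ((Term.var (Sum.inl i)).equal (Term.var (Sum.inr (g i))) : L.Formula (Fin n ⊕ Fin m)))

theorem Formula.realize_imageComp {A : Type*} [L.Structure A] {n m : ℕ} (g : Fin n → Fin m)
    (θ : L.Formula (Fin m)) (a : Fin n → A) :
    (θ.imageComp g).Realize a ↔ ∃ z : Fin m → A, θ.Realize z ∧ a = z ∘ g := by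
  unfold Formula.imageComp
  rw [Formula.realize_iExs]
  refine exists_congr fun z => ?_
  rw [Formula.realize_inf, Formula.realize_relabel, funext_iff]
  unfold Formula.Realize
  rw [BoundedFormula.realize_iInf]
  exact and_congr_right fun _ => forall_congr' fun i => Formula.realize_equal

theorem BoundedFormula.IsPositiveExistential.exs {α : Type} {n : ℕ} {φ : L.BoundedFormula α n}
    (h : φ.IsPositiveExistential) : φ.exs.IsPositiveExistential := by
  induction n with
  | zero => exact h
  | succ n ih => exact ih (.ex h)

theorem BoundedFormula.IsPositiveExistential.imageComp {n m : ℕ} (g : Fin n → Fin m)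
    {θ : L.Formula (Fin m)} (h : θ.IsPositiveExistential) :
    (θ.imageComp g).IsPositiveExistential := by
  refine .exs (.relabel (.inf (.relabel h _) (.iInf fun i => ?_)) _)
  exact .of_isAtomic (.equal _ _)

theorem autOrbit_comp {A : Type*} [L.Structure A] {n : ℕ} (a : Fin n → A) (g : A ≃[L] A) :
    L.autOrbit A (g ∘ a) = L.autOrbit A a := by
  ext b
  constructor
  · rintro ⟨h, rfl⟩
    exact ⟨h.comp g, rfl⟩
  · rintro ⟨h, rfl⟩
    refine ⟨h.comp g.symm, ?_⟩
    ext i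
    simp

theorem finite_range_of_factorsThrough {X Y Z : Type*} {f : X → Y} {g : X → Z}
    (hf : (Set.range f).Finite) (h : ∀ a b, f a = f b → g a = g b) : (Set.range g).Finite := by
  have := hf.to_subtype
  refine (Set.finite_range fun t : Set.range f => g t.2.choose).subset ?_
  rintro _ ⟨a, rfl⟩
  exact ⟨⟨f a, a, rfl⟩, h _ _ (Exists.choose_spec (⟨a, rfl⟩ : ∃ b, f b = f a))⟩

/-- A countable structure is oligomorphic if tuples sharing one of finitely many invariants form a
back-and-forth system. -/
theorem isOligomorphic_of_isBackAndForth [L.IsRelational] {A : Type*} [L.Structure A] [Countable A]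
    [Nonempty A] {X : ℕ → Type*} (τ : ∀ n, (Fin n → A) → X n) (hτ : ∀ n, (Set.range (τ n)).Finite)
    (h : IsBackAndForth L fun n (a b : Fin n → A) => τ n a = τ n b) : L.IsOligomorphic A := by
  intro n
  refine finite_range_of_factorsThrough (hτ n) fun a b hab => ?_
  obtain ⟨g, rfl⟩ := h.exists_equiv hab
  exact (autOrbit_comp a g).symm

end Tuples

/-! ### Positive existential types and the oligomorphic substructure -/

section PositiveTypes

variable {L : Language.{u, v}} {A : Type*} [L.Structure A]

/-- The positive existential type of a tuple. -/
def posType (L : Language.{u, v}) {A : Type*} [L.Structure A] {n : ℕ} (a : Fin n → A) :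
    Set (L.Formula (Fin n)) :=
  {φ ∈ {φ : L.Formula (Fin n) | φ.IsPositiveExistential} | φ.Realize a}

theorem posType_comp_subset {B : Type*} [L.Structure B] {n m : ℕ} {a : Fin n → A} {b : Fin n → B}
    (h : posType L a ⊆ posType L b) (g : Fin m → Fin n) :
    posType L (a ∘ g) ⊆ posType L (b ∘ g) := fun φ hφ => by
  have : φ.relabel g ∈ posType L a := ⟨hφ.1.relabel _, Formula.realize_relabel.2 hφ.2⟩
  exact ⟨hφ.1, Formula.realize_relabel.1 (h this).2⟩

theorem eq_of_posType_subset {B : Type*} [L.Structure B] {n : ℕ} {a : Fin n → A} {b : Fin n → B}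
    (h : posType L a ⊆ posType L b) {i j : Fin n} (hij : a i = a j) : b i = b j := by
  have : (Term.var i).equal (Term.var j) ∈ posType L a :=
    ⟨.of_isAtomic (.equal _ _), Formula.realize_equal.2 hij⟩
  exact Formula.realize_equal.1 (h this).2

theorem relMap_of_posType_subset {B : Type*} [L.Structure B] {n : ℕ} {a : Fin n → A}
    {b : Fin n → B} (h : posType L a ⊆ posType L b) {k : ℕ} (R : L.Relations k) (f : Fin k → Fin n)
    (hR : Structure.RelMap R (a ∘ f)) : Structure.RelMap R (b ∘ f) := by
  have : R.formula (fun i => Term.var (f i)) ∈ posType L a :=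
    ⟨.of_isAtomic (.rel _ _), Formula.realize_rel.2 hR⟩
  exact Formula.realize_rel.1 (h this).2

/-- Weakly oligomorphic structures realise finitely many positive existential types. -/
theorem IsWeaklyOligomorphic.finite_range_posType (hA : L.IsWeaklyOligomorphic A) (n : ℕ) :
    (Set.range fun a : Fin n → A => posType L a).Finite := by
  refine ((hA n).image fun R => {φ | φ.IsPositiveExistential ∧ ∀ b ∈ R, φ.Realize b}).subset ?_
  rintro _ ⟨a, rfl⟩
  -- The type of `a` is recovered from the relation it defines, as the set of positive existential
  -- formulas valid throughout that relation.
  refine ⟨L.typeRelation A (posType L a), ⟨posType L a, fun φ hφ => hφ.1, rfl⟩, ?_⟩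
  ext φ
  exact ⟨fun h => ⟨h.1, h.2 a fun ψ hψ => hψ.2⟩, fun h => ⟨h.1, fun b hb => hb φ h⟩⟩

variable (hA : ∀ n : ℕ, (Set.range fun a : Fin n → A => posType L a).Finite)

include hA in
theorem exists_generating_formula {n : ℕ} (a : Fin n → A) :
    ∃ θ : L.Formula (Fin n), θ.IsPositiveExistential ∧ θ.Realize a ∧
      ∀ b : Fin n → A, θ.Realize b → posType L a ⊆ posType L b := by
  obtain ⟨θ, h1, h2, h3⟩ := exists_isolating_formula
    {φ : L.Formula (Fin n) | φ.IsPositiveExistential} (fun ι _ f hf => .iInf hf) (hA n) a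
  exact ⟨θ, h1, h2, fun b hb φ hφ => ⟨hφ.1, h3 b hb φ hφ.1 hφ.2⟩⟩

/-- The positive existential type of `a` is maximal among those realised in the structure. -/
def IsPosMaximal (L : Language.{u, v}) {A : Type*} [L.Structure A] {n : ℕ} (a : Fin n → A) : Prop :=
  ∀ b : Fin n → A, posType L a ⊆ posType L b → posType L b ⊆ posType L a

theorem IsPosMaximal.of_subset {n : ℕ} {a b : Fin n → A} (ha : IsPosMaximal L a)
    (h : posType L a ⊆ posType L b) : IsPosMaximal L b := fun d hd =>
  (ha d (h.trans hd)).trans h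

include hA in
theorem exists_isPosMaximal {n : ℕ} (a : Fin n → A) :
    ∃ b : Fin n → A, posType L a ⊆ posType L b ∧ IsPosMaximal L b := by
  obtain ⟨_, h, ⟨b, rfl⟩, hb⟩ := (hA n).exists_le_maximal (Set.mem_range_self a)
  exact ⟨b, h, fun d hd => hb (Set.mem_range_self d) hd⟩

-- If `b` satisfies the projection along `g` of a generator of the type of `a`, then `b` is `z ∘ g`
-- with the type of `z` above that of `a`. Maximality of `a` bounds the type of `z`, hence that of
-- `b`.
include hA in
theorem IsPosMaximal.comp {n m : ℕ} {a : Fin n → A} (ha : IsPosMaximal L a) (g : Fin m → Fin n) :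
    IsPosMaximal L (a ∘ g) := by
  intro b hb
  obtain ⟨θ, h1, h2, h3⟩ := exists_generating_formula hA a
  have : θ.imageComp g ∈ posType L (a ∘ g) :=
    ⟨h1.imageComp g, (Formula.realize_imageComp g θ _).2 ⟨a, h2, rfl⟩⟩
  obtain ⟨z, hz, rfl⟩ := (Formula.realize_imageComp g θ _).1 (hb this).2
  exact posType_comp_subset (ha z (h3 z hz)) g

include hA in
theorem exists_posType_snoc_subset {n : ℕ} {a b : Fin n → A} (h : posType L a ⊆ posType L b)
    (x : A) : ∃ y, posType L (Fin.snoc a x : Fin (n + 1) → A) ⊆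
      posType L (Fin.snoc b y : Fin (n + 1) → A) := by
  obtain ⟨θ, h1, h2, h3⟩ := exists_generating_formula hA (Fin.snoc a x : Fin (n + 1) → A)
  have : θ.exLast ∈ posType L a := ⟨h1.exLast, (Formula.realize_exLast θ a).2 ⟨x, h2⟩⟩
  obtain ⟨y, hy⟩ := (Formula.realize_exLast θ b).1 (h this).2
  exact ⟨y, h3 _ hy⟩

-- Improve the whole tuple `(a, x)` to a maximal `r`. Since `a` is maximal, the initial part of `r`
-- has no larger type than `a`, so the last entry of `r` can be copied over `a`.
include hA in
theorem IsPosMaximal.exists_snoc {n : ℕ} {a : Fin n → A} (ha : IsPosMaximal L a) (x : A) :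
    ∃ y, IsPosMaximal L (Fin.snoc a y : Fin (n + 1) → A) ∧
      posType L (Fin.snoc a x : Fin (n + 1) → A) ⊆
        posType L (Fin.snoc a y : Fin (n + 1) → A) := by
  obtain ⟨r, hr, hmax⟩ := exists_isPosMaximal hA (Fin.snoc a x : Fin (n + 1) → A)
  have h1 : posType L a ⊆ posType L (r ∘ Fin.castSucc) := by
    have := posType_comp_subset hr Fin.castSucc
    rwa [Fin.snoc_comp_castSucc] at this
  obtain ⟨y, hy⟩ := exists_posType_snoc_subset hA (ha _ h1) (r (Fin.last n))
  have h2 : (Fin.snoc (r ∘ Fin.castSucc) (r (Fin.last n)) : Fin (n + 1) → A) = r :=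
    Fin.snoc_init_self r
  rw [h2] at hy
  exact ⟨y, hmax.of_subset hy, hr.trans hy⟩

include hA in
/-- There is a substructure all of whose tuples have a maximal type, and which contains, over each
of its tuples, an improvement of each element of the whole structure. -/
theorem exists_posMaximal_substructure [L.IsRelational] [Countable A] [Nonempty A] :
    ∃ S : L.Substructure A, Nonempty S ∧
      (∀ (n : ℕ) (a : Fin n → S), IsPosMaximal L (Subtype.val ∘ a)) ∧
      ∀ (n : ℕ) (a : Fin n → S) (x : A), ∃ y : S,
        posType L (Fin.snoc (Subtype.val ∘ a) x : Fin (n + 1) → A) ⊆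
          posType L (Fin.snoc (Subtype.val ∘ a) y.1 : Fin (n + 1) → A) := by
  obtain ⟨c, hc, hQ⟩ := exists_seq_of_extension (A := A) (B := A)
    (fun n p => IsPosMaximal L p)
    (fun n p x y => posType L (Fin.snoc p x : Fin (n + 1) → A) ⊆
        posType L (Fin.snoc p y : Fin (n + 1) → A))
    (fun p b _ => by rw [Subsingleton.elim b p])
    (fun n p x hp => hp.exists_snoc hA x)
  refine ⟨⟨Set.range c, fun f => isEmptyElim f⟩, ⟨⟨c 0, 0, rfl⟩⟩, fun n a => ?_, fun n a x => ?_⟩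
  · obtain ⟨f, m, hf⟩ := exists_bounded_indices c a
    convert (hc m).comp hA fun i => ⟨f i, (hf i).1⟩ using 1
    ext i
    exact (hf i).2
  · obtain ⟨f, m, hf⟩ := exists_bounded_indices c a
    -- With `s ≥ m`, all entries of `a` occur before stage `s`; the improvement over the longer
    -- tuple restricts to one over `a`.
    obtain ⟨s, hs, h⟩ := hQ m x
    refine ⟨⟨c s, s, rfl⟩, ?_⟩
    have key : ∀ y, (Fin.snoc (Subtype.val ∘ a) y : Fin (n + 1) → A) =
        (Fin.snoc (fun i : Fin s => c i) y : Fin (s + 1) → A) ∘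
          Fin.lastCases (Fin.last s) fun i => Fin.castSucc ⟨f i, (hf i).1.trans_le hs⟩ := fun y => by
      ext i
      refine Fin.lastCases ?_ (fun i => ?_) i
      · simp
      · simp [Fin.snoc, (hf i).2, (hf i).1.trans_le hs]
    rw [key, key]
    exact posType_comp_subset h _

/-- A Tarski–Vaught test for positive existential formulas. -/
theorem realize_iff_of_posType_snoc (S : L.Substructure A)
    (hS : ∀ (n : ℕ) (a : Fin n → S) (x : A), ∃ y : S,
        posType L (Fin.snoc (Subtype.val ∘ a) x : Fin (n + 1) → A) ⊆
          posType L (Fin.snoc (Subtype.val ∘ a) y.1 : Fin (n + 1) → A))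
    {α : Type} [Finite α] {k : ℕ} {φ : L.BoundedFormula α k} (hφ : φ.IsPositiveExistential)
    {v : α → S} {xs : Fin k → S} :
    φ.Realize (Subtype.val ∘ v) (Subtype.val ∘ xs) ↔ φ.Realize v xs := by
  refine ⟨fun h => ?_, fun h => hφ.realize_hom S.subtype.toHom h⟩
  induction hφ with
  | of_isAtomic hat => exact (hat.isQF.realize_embedding S.subtype).1 h
  | bot => exact h
  | top => simp
  | inf _ _ h1 h2 => rw [BoundedFormula.realize_inf] at *; exact ⟨h1 h.1, h2 h.2⟩
  | sup _ _ h1 h2 => rw [BoundedFormula.realize_sup] at *; exact h.imp h1 h2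
  | @ex k φ hφ ih =>
    -- All parameters are gathered into one tuple `w` of `S`, to which the hypothesis `hS` on
    -- improvements applies.
    rw [BoundedFormula.realize_ex] at *
    obtain ⟨x, hx⟩ := h
    obtain ⟨N, ⟨e⟩⟩ := Finite.exists_equiv_fin (α ⊕ Fin k)
    let w : Fin N → S := Sum.elim v xs ∘ e.symm
    let g : α ⊕ Fin (k + 1) → Fin (N + 1) := Sum.elim (fun i => (e (Sum.inl i)).castSucc)
      (Fin.lastCases (Fin.last N) fun j => (e (Sum.inr j)).castSucc)
    have key : ∀ y, (φ.flatten g).Realize (Fin.snoc (Subtype.val ∘ w) y : Fin (N + 1) → A) ↔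
        φ.Realize (Subtype.val ∘ v) (Fin.snoc (Subtype.val ∘ xs) y) := fun y => by
      rw [BoundedFormula.realize_flatten]
      refine iff_of_eq (congr_arg₂ _ ?_ ?_)
      · ext i
        simp [g, w]
      · ext i
        refine Fin.lastCases ?_ (fun i => ?_) i <;> simp [g, w]
    obtain ⟨y, hy⟩ := hS N w x
    refine ⟨y, ih ?_⟩
    rw [Fin.comp_snoc]
    exact (key y).1 (hy ⟨hφ.flatten g, (key x).2 hx⟩).2

/-- The positive existential theory of a countable weakly oligomorphic structure is that of a
countable oligomorphic structure. -/
theorem IsTheoryOfWeaklyOligomorphic.isTheoryOfOligomorphic [L.IsRelational] {T : Set L.Sentence}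
    (h : IsTheoryOfWeaklyOligomorphic.{u, v, w} T) : IsTheoryOfOligomorphic.{u, v, w} T := by
  obtain ⟨A, _, _, _, hA, rfl⟩ := h
  have hA := hA.finite_range_posType
  obtain ⟨S, hne, hmax, hS⟩ := exists_posMaximal_substructure hA
  have forth : ∀ {n : ℕ} {a b : Fin n → S},
      posType L (Subtype.val ∘ a) = posType L (Subtype.val ∘ b) → ∀ x : S, ∃ y : S,
        posType L (Subtype.val ∘ (Fin.snoc a x : Fin (n + 1) → S)) =
          posType L (Subtype.val ∘ (Fin.snoc b y : Fin (n + 1) → S)) := fun {n a b} hab x => by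
    obtain ⟨y, hy⟩ := exists_posType_snoc_subset hA hab.subset x.1
    -- The match `y` lies only in `A`; its improvement `z` lies in `S`, and maximality of the type
    -- of `(a, x)` makes the inclusion an equality.
    obtain ⟨z, hz⟩ := hS n b y
    have hsub := hy.trans hz
    have := hmax _ (Fin.snoc a x : Fin (n + 1) → S)
    refine ⟨z, ?_⟩
    rw [Fin.comp_snoc] at this
    rw [Fin.comp_snoc, Fin.comp_snoc]
    exact hsub.antisymm (this _ hsub)
  refine ⟨S, inferInstance, hne, inferInstance, ?_, ?_⟩
  · refine isOligomorphic_of_isBackAndForth (fun n a => posType L (Subtype.val ∘ a : Fin n → A))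
      (fun n => (hA n).subset ?_) ⟨?_, ?_, ?_, ?_⟩
    · rintro _ ⟨a, rfl⟩
      exact ⟨_, rfl⟩
    · intro n a b hab i j
      exact ⟨fun h => Subtype.ext (eq_of_posType_subset hab.subset (congr_arg Subtype.val h)),
        fun h => Subtype.ext (eq_of_posType_subset hab.superset (congr_arg Subtype.val h))⟩
    · intro n a b hab k R f
      exact ⟨relMap_of_posType_subset hab.subset R f, relMap_of_posType_subset hab.superset R f⟩
    · exact fun hab x => forth hab x
    · intro n a b hab y
      obtain ⟨x, hx⟩ := forth hab.symm y
      exact ⟨x, hx.symm⟩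
  · ext φ
    refine and_congr_right fun hφ => ?_
    have := realize_iff_of_posType_snoc S hS hφ (v := Empty.elim) (xs := Fin.elim0)
    unfold Sentence.Realize Formula.Realize
    convert this using 2

end PositiveTypes

end FirstOrder.Language

namespace FirstOrder.Language

/-! ### Complete types and categoricity of oligomorphic structures -/

section CompleteTypes

variable {L : Language.{u, v}} {M N : Type*} [L.Structure M] [L.Structure N]

/-- The complete type of a tuple. -/
def foType (L : Language.{u, v}) {M : Type*} [L.Structure M] {n : ℕ} (a : Fin n → M) :
    Set (L.Formula (Fin n)) :=
  {φ | φ.Realize a}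

theorem foType_eq_of_subset {n : ℕ} {a : Fin n → M} {b : Fin n → N}
    (h : foType L a ⊆ foType L b) : foType L a = foType L b := by
  refine h.antisymm fun φ hφ => ?_
  by_contra hn
  have : φ.not ∈ foType L a := Formula.realize_not.2 hn
  exact Formula.realize_not.1 (h this) hφ

theorem foType_comp_eq {n m : ℕ} {a : Fin n → M} {b : Fin n → N}
    (h : foType L a = foType L b) (g : Fin m → Fin n) :
    foType L (a ∘ g) = foType L (b ∘ g) := by
  refine foType_eq_of_subset fun φ hφ => ?_
  have : φ.relabel g ∈ foType L a := Formula.realize_relabel.2 hφ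
  exact Formula.realize_relabel.1 (h.subset this)

theorem foType_equiv_comp (g : M ≃[L] N) {n : ℕ} (a : Fin n → M) :
    foType L (g ∘ a) = foType L a :=
  Set.ext fun φ => StrongHomClass.realize_formula g φ

theorem realize_alls_relabel_sumInr {n : ℕ} (φ : L.Formula (Fin n)) :
    M ⊨ (BoundedFormula.relabel (Sum.inr : Fin n → Empty ⊕ Fin n) φ).alls ↔
      ∀ a : Fin n → M, φ.Realize a :=
  BoundedFormula.realize_alls.trans (forall_congr' fun _ => Formula.realize_relabel_sumInr φ)

theorem ElementarilyEquivalent.forall_realize_iff (h : M ≅[L] N) {n : ℕ} (φ : L.Formula (Fin n)) :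
    (∀ a : Fin n → M, φ.Realize a) ↔ ∀ a : Fin n → N, φ.Realize a := by
  rw [← realize_alls_relabel_sumInr, ← realize_alls_relabel_sumInr]
  exact elementarilyEquivalent_iff.1 h _

theorem ElementarilyEquivalent.foType_eq_of_isEmpty (h : M ≅[L] N) (a : Fin 0 → M)
    (b : Fin 0 → N) : foType L a = foType L b := by
  refine foType_eq_of_subset fun φ hφ => ?_
  exact (h.forall_realize_iff φ).1 (fun a' => Subsingleton.elim a a' ▸ hφ) b

theorem exists_isolating_formula_foType {n : ℕ}
    (hM : (Set.range fun a : Fin n → M => foType L a).Finite) (a : Fin n → M) :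
    ∃ θ : L.Formula (Fin n), θ.Realize a ∧
      ∀ b : Fin n → M, θ.Realize b → foType L a = foType L b := by
  obtain ⟨θ, -, h2, h3⟩ := exists_isolating_formula (Set.univ : Set (L.Formula (Fin n)))
    (fun _ _ _ _ => trivial) (by simpa [foType] using hM) a
  exact ⟨θ, h2, fun b hb => foType_eq_of_subset fun φ hφ => h3 b hb φ trivial hφ⟩

/-- If `M` realises finitely many types of each arity, equality of types is a back-and-forth system
between `M` and any elementarily equivalent structure. -/
theorem ElementarilyEquivalent.isBackAndForth (h : M ≅[L] N)
    (hM : ∀ n : ℕ, (Set.range fun a : Fin n → M => foType L a).Finite) :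
    IsBackAndForth L fun n (a : Fin n → M) (b : Fin n → N) => foType L a = foType L b where
  eq_iff {n a b} hab i j := by
    have := Set.ext_iff.1 hab ((Term.var i).equal (Term.var j))
    exact Formula.realize_equal.symm.trans (this.trans Formula.realize_equal)
  rel_iff {n a b} hab k R f := by
    have := Set.ext_iff.1 hab (R.formula fun i => Term.var (f i))
    exact Formula.realize_rel.symm.trans (this.trans Formula.realize_rel)
  forth {n a b} hab x := by
    obtain ⟨θ, h1, h2⟩ :=
      exists_isolating_formula_foType (hM (n + 1)) (Fin.snoc a x : Fin (n + 1) → M)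
    have : θ.exLast ∈ foType L a := (Formula.realize_exLast θ a).2 ⟨x, h1⟩
    rw [hab] at this
    obtain ⟨y, hy⟩ := (Formula.realize_exLast θ b).1 this
    refine ⟨y, foType_eq_of_subset fun φ hφ => ?_⟩
    -- That `θ` implies `φ` is a first-order statement about `M`, so it transfers to `N`.
    have := (h.forall_realize_iff (θ.imp φ)).1 fun d => Formula.realize_imp.2 fun hd => by
      have h3 := h2 d hd
      exact h3.subset hφ
    exact Formula.realize_imp.1 (this _) hy
  back {n a b} hab y := by
    by_contra! hn
    -- If no `x` works, finitely many formulas true of `(b, y)` exclude every type realised in `M`;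
    -- yet their conjunction, quantified existentially, belongs to the type of `a`.
    let I := {t ∈ Set.range fun a : Fin (n + 1) → M => foType L a |
      t ≠ foType L (Fin.snoc b y : Fin (n + 1) → N)}
    have : Finite I := ((hM (n + 1)).subset (Set.sep_subset _ _)).to_subtype
    have hI : ∀ t : I, ∃ φ : L.Formula (Fin (n + 1)),
        φ.Realize (Fin.snoc b y : Fin (n + 1) → N) ∧ φ ∉ t.1 := fun ⟨t, ⟨d, hd⟩, ht⟩ => by
      by_contra! hall
      subst hd
      exact ht (foType_eq_of_subset fun φ hφ => hall φ hφ).symm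
    choose f hf hft using hI
    have : (Formula.iInf f).exLast ∈ foType L b :=
      (Formula.realize_exLast _ b).2 ⟨y, Formula.realize_iInf.2 hf⟩
    rw [← hab] at this
    obtain ⟨x, hx⟩ := (Formula.realize_exLast _ a).1 this
    let t : I := ⟨foType L (Fin.snoc a x : Fin (n + 1) → M), ⟨_, rfl⟩, hn x⟩
    exact hft t (Formula.realize_iInf.1 hx t)

/-- A countable structure realising finitely many types of each arity is oligomorphic. -/
theorem isOligomorphic_of_finite_range_foType [L.IsRelational] [Countable M] [Nonempty M]
    (hM : ∀ n : ℕ, (Set.range fun a : Fin n → M => foType L a).Finite) : L.IsOligomorphic M :=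
  isOligomorphic_of_isBackAndForth (fun n a => foType L a) hM
    (ElementarilyEquivalent.isBackAndForth (rfl : M ≅[L] M) hM)

theorem mem_autOrbit_self {n : ℕ} (a : Fin n → M) : a ∈ L.autOrbit M a :=
  ⟨Equiv.refl L M, rfl⟩

theorem IsOligomorphic.finite_range_foType (hM : L.IsOligomorphic M) (n : ℕ) :
    (Set.range fun a : Fin n → M => foType L a).Finite := by
  refine finite_range_of_factorsThrough (hM n) fun a b hab => ?_
  have : b ∈ L.autOrbit M a := hab ▸ mem_autOrbit_self b
  obtain ⟨g, rfl⟩ := this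
  exact (foType_equiv_comp g a).symm

/-- Automorphisms preserve formulas, so each type relation is a union of orbits, and finitely many
orbits have finitely many unions. -/
theorem IsOligomorphic.isWeaklyOligomorphic (hM : L.IsOligomorphic M) :
    L.IsWeaklyOligomorphic M := by
  intro n
  refine ((hM n).finite_subsets.image Set.sUnion).subset ?_
  rintro _ ⟨Φ, -, rfl⟩
  refine ⟨{o | ∃ a ∈ L.typeRelation M Φ, o = L.autOrbit M a}, ?_, ?_⟩
  · rintro _ ⟨a, -, rfl⟩
    exact ⟨a, rfl⟩
  · ext b
    constructor
    · rintro ⟨_, ⟨a, ha, rfl⟩, ⟨g, rfl⟩⟩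
      exact fun φ hφ => (StrongHomClass.realize_formula g φ).2 (ha φ hφ)
    · exact fun hb => ⟨_, ⟨b, hb, rfl⟩, mem_autOrbit_self b⟩

/-- The complete theory of a countably infinite oligomorphic structure is `ω`-categorical. -/
theorem IsOligomorphic.isOmegaCategorical [L.IsRelational] {B : Type w} [L.Structure B]
    [Countable B] [Infinite B] (hB : L.IsOligomorphic B) :
    Theory.IsOmegaCategorical.{u, v, w} (L.completeTheory B) := by
  refine ⟨⟨Theory.ModelType.of _ B, Cardinal.mk_eq_aleph0 B⟩, ?_⟩
  have key : ∀ M : Theory.ModelType.{u, v, w} (L.completeTheory B),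
      Cardinal.mk M = Cardinal.aleph0 → Nonempty (B ≃[L] M) := fun M hM => by
    have : Countable M := Cardinal.mk_le_aleph0_iff.1 hM.le
    have h : B ≅[L] M := elementarilyEquivalent_iff.2 fun φ =>
      (realize_iff_of_model_completeTheory B M φ).symm
    obtain ⟨g, -⟩ := (h.isBackAndForth hB.finite_range_foType).exists_equiv
      (h.foType_eq_of_isEmpty Fin.elim0 Fin.elim0)
    exact ⟨g⟩
  intro M N hM hN
  obtain ⟨f⟩ := key M hM
  obtain ⟨g⟩ := key N hN
  exact ⟨g.comp f.symm⟩

end CompleteTypes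

/-! ### Blowing up elements to infinitely many copies -/

section BlowUp

/-- The structure obtained by replacing every element with infinitely many copies of itself. -/
def BlowUp (A : Type*) : Type _ := A × ℕ

variable {L : Language.{u, v}} [L.IsRelational] {A : Type*} [L.Structure A]

instance : L.Structure (BlowUp A) where
  funMap F := isEmptyElim F
  RelMap R x := Structure.RelMap R fun i => (x i).1

instance [Countable A] : Countable (BlowUp A) := inferInstanceAs (Countable (A × ℕ))

instance [Nonempty A] : Infinite (BlowUp A) := inferInstanceAs (Infinite (A × ℕ))

/-- The projection and the embedding as copy `0` are homomorphisms in both directions. -/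
theorem positiveExistentialTheory_blowUp :
    L.positiveExistentialTheory (BlowUp A) = L.positiveExistentialTheory A := by
  let f : A →[L] BlowUp A := ⟨fun a => (a, 0), fun F => isEmptyElim F, fun _ _ h => h⟩
  let g : BlowUp A →[L] A := ⟨Prod.fst, fun F => isEmptyElim F, fun _ _ h => h⟩
  ext φ
  refine and_congr_right fun hφ => ⟨fun h => ?_, fun h => ?_⟩
  · have := hφ.realize_hom g h
    rwa [Subsingleton.elim (g ∘ default) default, Subsingleton.elim (g ∘ default) default] at this
  · have := hφ.realize_hom f h
    rwa [Subsingleton.elim (f ∘ default) default, Subsingleton.elim (f ∘ default) default] at this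

theorem snoc_eq_snoc_iff_of_forall {X Y : Type*} {n : ℕ} {a : Fin n → X} {b : Fin n → Y} {x : X}
    {y : Y} (h : ∀ i j, a i = a j ↔ b i = b j) (hx : ∀ i, a i = x ↔ b i = y) (i j : Fin (n + 1)) :
    (Fin.snoc a x : Fin (n + 1) → X) i = (Fin.snoc a x : Fin (n + 1) → X) j ↔
      (Fin.snoc b y : Fin (n + 1) → Y) i = (Fin.snoc b y : Fin (n + 1) → Y) j := by
  refine Fin.lastCases ?_ (fun i => ?_) i <;> refine Fin.lastCases ?_ (fun j => ?_) j
  · simp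
  · simpa [eq_comm] using hx j
  · simpa using hx i
  · simpa using h i j

omit [L.IsRelational] in
theorem exists_snoc_blowUp {n : ℕ} {a b : Fin n → BlowUp A} {g : A ≃[L] A}
    (hg : ∀ i, (b i).1 = g (a i).1) (h : ∀ i j, a i = a j ↔ b i = b j) (x : BlowUp A) :
    ∃ y : BlowUp A, y.1 = g x.1 ∧ ∀ i, a i = x ↔ b i = y := by
  by_cases hx : ∃ j, a j = x
  · obtain ⟨j, rfl⟩ := hx
    exact ⟨b j, hg j, fun i => h i j⟩
  · push Not at hx
    -- A new element is sent to a copy whose index exceeds all those used by `b`.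
    obtain ⟨k, hk⟩ := Finite.exists_le fun i => (b i).2
    refine ⟨(g x.1, k + 1), rfl, fun i => iff_of_false (hx i) fun hi => ?_⟩
    have := hk i
    rw [hi] at this
    exact Nat.not_succ_le_self k this

/-- The finite invariant of a tuple is the orbit of its projection together with its equality
pattern. -/
theorem IsOligomorphic.blowUp [Countable A] [Nonempty A] (hA : L.IsOligomorphic A) :
    L.IsOligomorphic (BlowUp A) := by
  have unfold : ∀ {n : ℕ} {a b : Fin n → BlowUp A},
      (L.autOrbit A fun i => (a i).1, {p : Fin n × Fin n | a p.1 = a p.2}) =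
        (L.autOrbit A fun i => (b i).1, {p : Fin n × Fin n | b p.1 = b p.2}) ↔
      (∃ g : A ≃[L] A, ∀ i, (b i).1 = g (a i).1) ∧ ∀ i j, a i = a j ↔ b i = b j := by
    intro n a b
    rw [Prod.mk.injEq]
    refine and_congr ⟨fun h => ?_, fun ⟨g, hg⟩ => ?_⟩ ⟨fun h i j => ?_, fun h => ?_⟩
    · have := mem_autOrbit_self (L := L) fun i => (b i).1
      rw [← h] at this
      obtain ⟨g, hg⟩ := this
      exact ⟨g, fun i => congr_fun hg i⟩
    · rw [← autOrbit_comp (fun i => (a i).1) g]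
      exact congr_arg _ (funext fun i => (hg i).symm)
    · exact Set.ext_iff.1 h (i, j)
    · exact Set.ext fun p => h p.1 p.2
  have forth : ∀ {n : ℕ} {a b : Fin n → BlowUp A},
      (∃ g : A ≃[L] A, ∀ i, (b i).1 = g (a i).1) ∧ (∀ i j, a i = a j ↔ b i = b j) →
      ∀ x : BlowUp A, ∃ y : BlowUp A,
        (∃ g : A ≃[L] A, ∀ i, ((Fin.snoc b y : Fin (n + 1) → BlowUp A) i).1 =
          g ((Fin.snoc a x : Fin (n + 1) → BlowUp A) i).1) ∧
        ∀ i j, (Fin.snoc a x : Fin (n + 1) → BlowUp A) i =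
            (Fin.snoc a x : Fin (n + 1) → BlowUp A) j ↔
          (Fin.snoc b y : Fin (n + 1) → BlowUp A) i =
            (Fin.snoc b y : Fin (n + 1) → BlowUp A) j := by
    rintro n a b ⟨⟨g, hg⟩, h⟩ x
    obtain ⟨y, hy, hxy⟩ := exists_snoc_blowUp hg h x
    refine ⟨y, ⟨g, fun i => ?_⟩, snoc_eq_snoc_iff_of_forall h hxy⟩
    refine Fin.lastCases ?_ (fun i => ?_) i
    · simpa using hy
    · simpa using hg i
  refine isOligomorphic_of_isBackAndForth
    (fun n (a : Fin n → BlowUp A) =>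
      (L.autOrbit A fun i => (a i).1, {p : Fin n × Fin n | a p.1 = a p.2}))
    (fun n => ?_) ⟨?_, ?_, ?_, ?_⟩
  · refine ((hA n).prod (Set.toFinite (Set.univ : Set (Set (Fin n × Fin n))))).subset ?_
    rintro _ ⟨a, rfl⟩
    exact ⟨⟨_, rfl⟩, trivial⟩
  · exact fun hab => (unfold.1 hab).2
  · intro n a b hab k R f
    obtain ⟨⟨g, hg⟩, -⟩ := unfold.1 hab
    have : (fun i => ((b ∘ f) i).1) = g ∘ fun i => ((a ∘ f) i).1 := funext fun i => hg (f i)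
    change Structure.RelMap R (fun i => ((a ∘ f) i).1) ↔ Structure.RelMap R fun i => ((b ∘ f) i).1
    rw [this]
    exact (g.map_rel R _).symm
  · intro n a b hab x
    obtain ⟨y, hy⟩ := forth (unfold.1 hab) x
    exact ⟨y, unfold.2 hy⟩
  · intro n a b hab y
    obtain ⟨x, hx⟩ := forth (unfold.1 hab.symm) y
    exact ⟨x, (unfold.2 hx).symm⟩

end BlowUp

/-! ### Passing between structures and theories -/

section Theories

variable {L : Language.{u, v}} {T : Set L.Sentence}

theorem IsTheoryOfOligomorphic.isTheoryOfWeaklyOligomorphic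
    (h : IsTheoryOfOligomorphic.{u, v, w} T) : IsTheoryOfWeaklyOligomorphic.{u, v, w} T := by
  obtain ⟨A, _, h1, h2, hA, rfl⟩ := h
  exact ⟨A, inferInstance, h1, h2, hA.isWeaklyOligomorphic, rfl⟩

theorem Theory.IsComplete.positiveExistentialPart_eq {S : L.Theory} (hS : S.IsComplete) (M : Type*)
    [L.Structure M] [M ⊨ S] [Nonempty M] :
    S.positiveExistentialPart = L.positiveExistentialTheory M :=
  Set.ext fun φ => and_congr_right fun _ => (hS.realize_sentence_iff φ M).symm

theorem IsTheoryOfOligomorphic.isPartOfOmegaCategorical [L.IsRelational]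
    (h : IsTheoryOfOligomorphic.{u, v, w} T) : IsPartOfOmegaCategorical.{u, v, w} T := by
  obtain ⟨A, _, _, _, hA, rfl⟩ := h
  refine ⟨L.completeTheory (BlowUp A), completeTheory.isComplete L (BlowUp A),
    hA.blowUp.isOmegaCategorical, ?_⟩
  rw [(completeTheory.isComplete L (BlowUp A)).positiveExistentialPart_eq (BlowUp A),
    positiveExistentialTheory_blowUp]

end Theories

end FirstOrder.Language

namespace FirstOrder.Language

/-! ### Isolated types in a structure realising all types -/

section IsolatedTypes

variable {L : Language.{u, v}} {M : Type*} [L.Structure M]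

/-- Every finitely satisfiable set of formulas in finitely many variables is realised in `M`. -/
def RealizesTypes (L : Language.{u, v}) (M : Type*) [L.Structure M] : Prop :=
  ∀ (n : ℕ) (Φ : Set (L.Formula (Fin n))),
    (∀ F : Finset (L.Formula (Fin n)), (F : Set (L.Formula (Fin n))) ⊆ Φ →
      ∃ a : Fin n → M, ∀ φ ∈ F, φ.Realize a) →
    ∃ a : Fin n → M, ∀ φ ∈ Φ, φ.Realize a

/-- The complete type of `a` is generated by a single formula. -/
def IsIsolated (L : Language.{u, v}) {M : Type*} [L.Structure M] {n : ℕ} (a : Fin n → M) : Prop :=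
  ∃ θ : L.Formula (Fin n), θ.Realize a ∧ ∀ b : Fin n → M, θ.Realize b → foType L a = foType L b

theorem IsIsolated.comp {n m : ℕ} {a : Fin n → M} (ha : IsIsolated L a) (g : Fin m → Fin n) :
    IsIsolated L (a ∘ g) := by
  obtain ⟨θ, h1, h2⟩ := ha
  refine ⟨θ.imageComp g, (Formula.realize_imageComp g θ _).2 ⟨a, h1, rfl⟩, fun b hb => ?_⟩
  obtain ⟨z, hz, rfl⟩ := (Formula.realize_imageComp g θ _).1 hb
  exact foType_comp_eq (h2 z hz) g

/-- A satisfiable formula with no isolated realisations could be refined so as to omit any given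
tuple. -/
theorem exists_refinement {n : ℕ} {φ ψ : L.Formula (Fin n)}
    (hφ : ∀ a : Fin n → M, φ.Realize a → ¬ IsIsolated L a)
    (hψ : ∀ a : Fin n → M, ψ.Realize a → φ.Realize a) (h : ∃ a : Fin n → M, ψ.Realize a)
    (d : Fin n → M) :
    ∃ χ : L.Formula (Fin n), (∃ a : Fin n → M, χ.Realize a) ∧
      (∀ a : Fin n → M, χ.Realize a → ψ.Realize a) ∧ ¬ χ.Realize d := by
  obtain ⟨a, ha⟩ := h
  have := hφ a (hψ a ha)
  unfold IsIsolated at this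
  push Not at this
  obtain ⟨b, hb, hab⟩ := this ψ ha
  obtain ⟨χ, hχa, hχb⟩ : ∃ χ : L.Formula (Fin n), χ.Realize a ∧ ¬ χ.Realize b := by
    by_contra! hall
    exact hab (foType_eq_of_subset fun χ hχ => hall χ hχ)
  by_cases hd : χ.Realize d
  · exact ⟨ψ ⊓ χ.not, ⟨b, Formula.realize_inf.2 ⟨hb, Formula.realize_not.2 hχb⟩⟩,
      fun e he => (Formula.realize_inf.1 he).1,
      fun he => Formula.realize_not.1 (Formula.realize_inf.1 he).2 hd⟩
  · exact ⟨ψ ⊓ χ, ⟨a, Formula.realize_inf.2 ⟨ha, hχa⟩⟩,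
      fun e he => (Formula.realize_inf.1 he).1, fun he => hd (Formula.realize_inf.1 he).2⟩

/-- Otherwise `φ` could be refined step by step, omitting the `k`-th tuple of `M` at step `k`. The
resulting chain is finitely satisfiable, hence realised by some tuple, which was omitted. -/
theorem RealizesTypes.exists_isIsolated [Countable M] (hM : RealizesTypes L M) {n : ℕ}
    {φ : L.Formula (Fin n)} {a : Fin n → M} (ha : φ.Realize a) :
    ∃ b : Fin n → M, φ.Realize b ∧ IsIsolated L b := by
  by_contra! hφ
  have : Nonempty (Fin n → M) := ⟨a⟩
  obtain ⟨d, hd⟩ := exists_surjective_nat (Fin n → M)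
  let P := {ψ : L.Formula (Fin n) //
    (∃ a : Fin n → M, ψ.Realize a) ∧ ∀ a : Fin n → M, ψ.Realize a → φ.Realize a}
  have step : ∀ (ψ : P) (k : ℕ), ∃ χ : P,
      (∀ a : Fin n → M, χ.1.Realize a → ψ.1.Realize a) ∧ ¬ χ.1.Realize (d k) := fun ψ k => by
    obtain ⟨χ, h1, h2, h3⟩ := exists_refinement hφ ψ.2.2 ψ.2.1 (d k)
    exact ⟨⟨χ, h1, fun a ha => ψ.2.2 a (h2 a ha)⟩, h2, h3⟩
  choose next hnext1 hnext2 using step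
  let s : ℕ → P := fun k => Nat.rec ⟨φ, ⟨a, ha⟩, fun _ h => h⟩ (fun k ψ => next ψ k) k
  have mono : ∀ i j, i ≤ j → ∀ a : Fin n → M, (s j).1.Realize a → (s i).1.Realize a := by
    intro i j hij
    induction hij with
    | refl => exact fun _ h => h
    | step _ ih => exact fun a h => ih a (hnext1 _ _ a h)
  obtain ⟨b, hb⟩ := hM n (Set.range fun k => (s k).1) fun F hF => by
    choose f hf using fun ψ : F => hF ψ.2
    obtain ⟨m, hm⟩ := Finite.exists_le f
    obtain ⟨a, ha⟩ := (s m).2.1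
    refine ⟨a, fun ψ hψ => ?_⟩
    have := mono _ _ (hm ⟨ψ, hψ⟩) a ha
    rwa [show (s (f ⟨ψ, hψ⟩)).1 = ψ from hf ⟨ψ, hψ⟩] at this
  obtain ⟨k, rfl⟩ := hd b
  exact hnext2 (s k) k (hb _ ⟨k + 1, rfl⟩)

/-- A countable structure realising all types over the empty set has an elementary substructure all
of whose tuples have isolated types. -/
theorem RealizesTypes.exists_isIsolated_elementarySubstructure [L.IsRelational] [Countable M]
    [Nonempty M] [∀ n : ℕ, Countable (L.Formula (Fin n))] (hM : RealizesTypes L M) :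
    ∃ S : L.ElementarySubstructure M, ∀ (n : ℕ) (a : Fin n → S),
      IsIsolated L (Subtype.val ∘ a : Fin n → M) := by
  have : Nonempty (Σ n, L.Formula (Fin (n + 1))) := ⟨⟨0, ⊤⟩⟩
  obtain ⟨c, hc, hQ⟩ := exists_seq_of_extension (A := M) (B := Σ n, L.Formula (Fin (n + 1)))
    (fun n p => IsIsolated L p)
    (fun s p φ y => ∀ h : φ.1 ≤ s,
      (∃ x, φ.2.Realize (Fin.snoc (p ∘ Fin.castLE h) x : Fin (φ.1 + 1) → M)) →
        φ.2.Realize (Fin.snoc (p ∘ Fin.castLE h) y : Fin (φ.1 + 1) → M))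
    (fun p => ⟨⊤, Formula.realize_top.2 trivial, fun b _ => by rw [Subsingleton.elim b p]⟩)
    (by
      rintro s p ⟨n, φ⟩ ⟨ψ, hψ, hp⟩
      -- `χ` encodes the requirement: `φ` in the variables for the first `n` entries and the new one
      -- if it has a witness, `⊤` otherwise.
      have key : ∃ χ : L.Formula (Fin (s + 1)),
          (∃ x, χ.Realize (Fin.snoc p x : Fin (s + 1) → M)) ∧ ∀ y : M,
            χ.Realize (Fin.snoc p y : Fin (s + 1) → M) → ∀ h : n ≤ s,
              (∃ x, φ.Realize (Fin.snoc (p ∘ Fin.castLE h) x : Fin (n + 1) → M)) →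
                φ.Realize (Fin.snoc (p ∘ Fin.castLE h) y : Fin (n + 1) → M) := by
        by_cases hx : ∃ (h : n ≤ s) (x : M),
            φ.Realize (Fin.snoc (p ∘ Fin.castLE h) x : Fin (n + 1) → M)
        · obtain ⟨h, x, hx⟩ := hx
          have e : ∀ y, (Fin.snoc p y : Fin (s + 1) → M) ∘
              (Fin.lastCases (Fin.last s) fun i => Fin.castSucc (Fin.castLE h i)) =
                (Fin.snoc (p ∘ Fin.castLE h) y : Fin (n + 1) → M) := fun y => by
            ext i
            refine Fin.lastCases ?_ (fun i => ?_) i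
            · simp
            · simp only [Function.comp_apply, Fin.lastCases_castSucc, Fin.snoc_castSucc]
          refine ⟨φ.relabel (Fin.lastCases (Fin.last s) fun i => Fin.castSucc (Fin.castLE h i)),
            ⟨x, ?_⟩, fun y hy _ _ => ?_⟩
          · rw [Formula.realize_relabel, e]
            exact hx
          · rwa [Formula.realize_relabel, e] at hy
        · obtain ⟨x⟩ := ‹Nonempty M›
          exact ⟨⊤, ⟨x, Formula.realize_top.2 trivial⟩,
            fun y _ h hex => (hx ⟨h, hex⟩).elim⟩
      obtain ⟨χ, ⟨x, hx⟩, hχ⟩ := key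
      have h1 : (χ ⊓ ψ.relabel Fin.castSucc).Realize (Fin.snoc p x : Fin (s + 1) → M) :=
        Formula.realize_inf.2 ⟨hx, Formula.realize_relabel.2 (by rwa [Fin.snoc_comp_castSucc])⟩
      obtain ⟨b, hb, θ, hθ, hbθ⟩ := hM.exists_isIsolated h1
      rw [Formula.realize_inf, Formula.realize_relabel] at hb
      -- As `ψ` isolates the type of `p`, the initial part of `b` has that type, so a witness over
      -- it gives one over `p`.
      have h2 : (θ ⊓ χ).exLast ∈ foType L (b ∘ Fin.castSucc) := by
        refine (Formula.realize_exLast _ _).2 ⟨b (Fin.last s), ?_⟩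
        have e : (Fin.snoc (b ∘ Fin.castSucc) (b (Fin.last s)) : Fin (s + 1) → M) = b :=
          Fin.snoc_init_self b
        rw [e]
        exact Formula.realize_inf.2 ⟨hθ, hb.1⟩
      rw [← hp _ hb.2] at h2
      obtain ⟨y, hy⟩ := (Formula.realize_exLast _ _).1 h2
      rw [Formula.realize_inf] at hy
      have h3 := hbθ _ hy.1
      exact ⟨y, ⟨θ, hy.1, fun d hd => h3.symm.trans (hbθ d hd)⟩, hχ y hy.2⟩)
  let S : L.Substructure M := ⟨Set.range c, fun f => isEmptyElim f⟩
  have hS : S.IsElementary := by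
    refine S.isElementary_of_exists fun n φ a x hx => ?_
    obtain ⟨f, m, hf⟩ := exists_bounded_indices c a
    let g : Empty ⊕ Fin (n + 1) → Fin (m + 1) :=
      Sum.elim Empty.elim (Fin.lastCases (Fin.last m) fun i => Fin.castSucc ⟨f i, (hf i).1⟩)
    have key : ∀ y, (φ.flatten g).Realize (Fin.snoc (fun i : Fin m => c i) y : Fin (m + 1) → M) ↔
        φ.Realize default (Fin.snoc (Subtype.val ∘ a) y : Fin (n + 1) → M) := fun y => by
      rw [BoundedFormula.realize_flatten]
      refine iff_of_eq (congr_arg₂ _ (Subsingleton.elim _ _) ?_)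
      ext i
      refine Fin.lastCases ?_ (fun i => ?_) i
      · simp [g]
      · simp [g, Fin.snoc, (hf i).1, (hf i).2]
    obtain ⟨s, hs, h⟩ := hQ m ⟨m, φ.flatten g⟩
    refine ⟨⟨c s, s, rfl⟩, (key _).1 (h hs ⟨x, (key x).2 hx⟩)⟩
  refine ⟨⟨S, hS⟩, fun n a => ?_⟩
  obtain ⟨f, m, hf⟩ := exists_bounded_indices c a
  convert (hc m).comp (fun i => (⟨f i, (hf i).1⟩ : Fin m)) using 1
  ext i
  exact (hf i).2

/-- With infinitely many types, the negations of all isolating formulas would be finitely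
satisfiable, hence realised by a tuple that violates its own isolating formula. -/
theorem RealizesTypes.finite_range_foType (hM : RealizesTypes L M) {n : ℕ}
    (h : ∀ a : Fin n → M, IsIsolated L a) :
    (Set.range fun a : Fin n → M => foType L a).Finite := by
  choose θ h1 h2 using h
  by_contra hinf
  obtain ⟨a, ha⟩ := hM n (Set.range fun a => (θ a).not) fun F hF => by
    by_contra! hall
    choose d hd using fun φ : F => hF φ.2
    refine hinf ((Set.finite_range fun φ : F => foType L (d φ)).subset ?_)
    rintro _ ⟨a, rfl⟩
    obtain ⟨φ, hφ, hn⟩ := hall a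
    refine ⟨⟨φ, hφ⟩, h2 _ a ?_⟩
    have hdφ : (θ (d ⟨φ, hφ⟩)).not = φ := hd ⟨φ, hφ⟩
    by_contra hθ
    exact hn (hdφ ▸ Formula.realize_not.2 hθ)
  exact Formula.realize_not.1 (ha _ ⟨a, rfl⟩) (h1 a)

end IsolatedTypes

/-! ### From categoricity to oligomorphy -/

section RyllNardzewski

variable {L : Language.{u, v}} {S : L.Theory}

theorem Theory.IsComplete.elementarilyEquivalent (hS : S.IsComplete) (M N : Type*) [L.Structure M]
    [L.Structure N] [M ⊨ S] [N ⊨ S] [Nonempty M] [Nonempty N] : M ≅[L] N :=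
  elementarilyEquivalent_iff.2 fun φ =>
    (hS.realize_sentence_iff φ M).trans (hS.realize_sentence_iff φ N).symm

/-- The countable model of a complete `ω`-categorical theory in a countable language realises all
types. -/
theorem Theory.IsComplete.realizesTypes [Countable L.Symbols] (hS : S.IsComplete)
    (hcat : Cardinal.Categorical Cardinal.aleph0.{w} S) (M : Theory.ModelType.{u, v, w} S)
    (hM : Cardinal.mk M = Cardinal.aleph0) : RealizesTypes L M := by
  classical
  intro n Φ hΦ
  have : Infinite M := Cardinal.infinite_iff.2 hM.ge
  let T : L[[Fin n]].Theory :=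
    (L.lhomWithConstants (Fin n)).onTheory S ∪ Formula.equivSentence '' Φ
  have hT : T.IsSatisfiable := by
    rw [Theory.isSatisfiable_iff_isFinitelySatisfiable]
    intro T0 hT0
    -- Only finitely many formulas of `Φ` occur in `T0`; interpreting the constants by a tuple of
    -- `M` satisfying them gives a model.
    obtain ⟨a, ha⟩ := hΦ ((T0.preimage Formula.equivSentence
      Formula.equivSentence.injective.injOn).filter (· ∈ Φ)) fun φ hφ => by
        simpa using (Finset.mem_filter.1 hφ).2
    let : (constantsOn (Fin n)).Structure M := constantsOn.structure a
    have : M ⊨ (L.lhomWithConstants (Fin n)).onTheory S :=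
      (LHom.onTheory_model _ _).2 inferInstance
    have : M ⊨ (T0 : L[[Fin n]].Theory) := by
      refine ⟨fun ψ hψ => ?_⟩
      rcases hT0 hψ with h | ⟨φ, hφ, rfl⟩
      · exact Theory.realize_sentence_of_mem _ h
      · refine (Formula.realize_equivSentence M φ).2 (ha φ ?_)
        exact Finset.mem_filter.2 ⟨Finset.mem_preimage.2 hψ, hφ⟩
    exact Theory.Model.isSatisfiable M
  obtain ⟨K⟩ := hT
  have hK : Infinite K := by
    let := (L.lhomWithConstants (Fin n)).reduct K
    have h1 : K ⊨ (L.lhomWithConstants (Fin n)).onTheory S :=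
      K.is_model.mono Set.subset_union_left
    have : K ⊨ S := (LHom.onTheory_model _ _).1 h1
    exact (hS.elementarilyEquivalent M K).infinite
  obtain ⟨N, hN⟩ := Theory.exists_model_card_eq ⟨K, hK⟩ Cardinal.aleph0.{w} le_rfl (by
    have : L[[Fin n]].card ≤ Cardinal.aleph0 := Cardinal.mk_le_aleph0_iff.2 inferInstance
    simpa using this)
  let := (L.lhomWithConstants (Fin n)).reduct N
  have h1 : N ⊨ (L.lhomWithConstants (Fin n)).onTheory S := N.is_model.mono Set.subset_union_left
  have : N ⊨ S := (LHom.onTheory_model _ _).1 h1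
  obtain ⟨g⟩ := hcat (Theory.ModelType.of S N) M hN hM
  refine ⟨g ∘ fun i => (L.con i : N), fun φ hφ => ?_⟩
  refine (StrongHomClass.realize_formula g φ).2 ((Formula.realize_equivSentence N φ).1 ?_)
  exact Theory.realize_sentence_of_mem T (Or.inr ⟨φ, hφ, rfl⟩)

/-- The direction of the Ryll-Nardzewski theorem from categoricity to oligomorphy. -/
theorem Theory.IsComplete.isOligomorphic [L.IsRelational] [Countable L.Symbols] (hS : S.IsComplete)
    (hcat : Cardinal.Categorical Cardinal.aleph0.{w} S) (M : Theory.ModelType.{u, v, w} S)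
    (hM : Cardinal.mk M = Cardinal.aleph0) : L.IsOligomorphic M := by
  have : Infinite M := Cardinal.infinite_iff.2 hM.ge
  have : Countable M := Cardinal.mk_le_aleph0_iff.1 hM.le
  have hreal := hS.realizesTypes hcat M hM
  refine isOligomorphic_of_finite_range_foType fun n => hreal.finite_range_foType fun a => ?_
  obtain ⟨N, hN⟩ := hreal.exists_isIsolated_elementarySubstructure
  have hNM : N ≅[L] M := N.elementarilyEquivalent
  have : Infinite N := hNM.symm.infinite
  have : N ⊨ S := (N.theory_model_iff S).2 inferInstance
  -- `N` has only isolated types in `M`; moving `a` into `N` by `g` keeps its type, which is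
  -- therefore isolated.
  obtain ⟨g⟩ := hcat M (Theory.ModelType.of S N) hM (Cardinal.mk_eq_aleph0 N)
  have key : foType L (Subtype.val ∘ g ∘ a : Fin n → M) = foType L a := by
    have h1 : foType L (g ∘ a) = foType L a := foType_equiv_comp g a
    rw [← h1]
    exact Set.ext fun φ => N.subtype.map_formula φ (g ∘ a)
  obtain ⟨θ, h1, h2⟩ := hN n (g ∘ a)
  exact ⟨θ, key.subset h1, fun b hb => key.symm.trans (h2 b hb)⟩

theorem IsPartOfOmegaCategorical.isTheoryOfOligomorphic [L.IsRelational] [Countable L.Symbols]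
    {T : Set L.Sentence} (h : IsPartOfOmegaCategorical.{u, v, w} T) :
    IsTheoryOfOligomorphic.{u, v, w} T := by
  obtain ⟨S, hS, ⟨⟨M, hM⟩, hcat⟩, rfl⟩ := h
  exact ⟨M, inferInstance, inferInstance, Cardinal.mk_le_aleph0_iff.1 hM.le,
    hS.isOligomorphic hcat M hM, hS.positiveExistentialPart_eq M⟩

end RyllNardzewski

end FirstOrder.Language

theorem mainTheorem5 {L : FirstOrder.Language.{u, v}} [L.IsRelational] (T : Set L.Sentence)
    (hT : ∀ φ ∈ T, φ.IsPositiveExistential) :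
    (Countable (Σ n, L.Relations n) →
      List.TFAE
        [FirstOrder.Language.IsTheoryOfWeaklyOligomorphic.{u, v, w} T,
          FirstOrder.Language.IsPartOfOmegaCategorical.{u, v, w} T,
          FirstOrder.Language.IsTheoryOfOligomorphic.{u, v, w} T]) ∧
    (FirstOrder.Language.IsTheoryOfWeaklyOligomorphic.{u, v, w} T ↔
      FirstOrder.Language.IsTheoryOfOligomorphic.{u, v, w} T) ∧
    (FirstOrder.Language.IsTheoryOfWeaklyOligomorphic.{u, v, w} T →
      FirstOrder.Language.IsPartOfOmegaCategorical.{u, v, w} T) := by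
  refine ⟨fun hL => ?_, ⟨fun h => h.isTheoryOfOligomorphic, fun h =>
    h.isTheoryOfWeaklyOligomorphic⟩, fun h => h.isTheoryOfOligomorphic.isPartOfOmegaCategorical⟩
  have : Countable L.Symbols := inferInstanceAs (Countable ((Σ n, L.Functions n) ⊕ _))
  tfae_have 1 → 3 := fun h => h.isTheoryOfOligomorphic
  tfae_have 3 → 2 := fun h => h.isPartOfOmegaCategorical
  tfae_have 2 → 3 := fun h => h.isTheoryOfOligomorphic
  tfae_have 3 → 1 := fun h => h.isTheoryOfWeaklyOligomorphic
  tfae_finish
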